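/- Let $n,r,t,s\ge 1$, $k\ge 0$ and $q\ge 2$ be integers, and write $[m]=\{1,\dots,m\}$. A family $(\Gamma_l(j))_{l\in[t],\,j\in[n]}$ of subsets of $[n]$ satisfies the exact $(r,t,s)$-condition if, for every $j\in[n]$: (1) $|\Gamma_l(j)|=r+1$ and $j\in\Gamma_l(j)$ for all $l\in[t]$; (2) $|\Gamma_{l_1}(j)\cap\Gamma_{l_2}(j)|=s+1$ for all distinct $l_1,l_2\in[t]$; (3) $\Gamma_{l_1}(j)\cap\Gamma_{l_2}(j)\cap\Gamma_{l_3}(j)=\{j\}$ for all pairwise distinct $l_1,l_2,l_3\in[t]$. An exact $(r,t,s)$-qLRC on $n$ qudits of local dimension $q$ is a linear subspace $\mathcal C\subseteq(\mathbb C^q)^{\otimes n}$ for which there are a family $(\Gamma_l(j))$ satisfying the exact $(r,t,s)$-condition and, for all $l\in[t]$ and $j\in[n]$, a quantum channel $\mathrm{Rec}_{l,j}$ supported on the qudits in $\Gamma_l(j)$ (that is, of the form $\Phi\otimes\mathrm{id}$ with $\Phi$ a channel on these qudits), such that for every unit vector $|\psi\rangle\in\mathcal C$ $$\mathrm{Rec}_{l,j}\bigl(\mathrm{Tr}_j(|\psi\rangle\langle\psi|)\bigr)=|\psi\rangle\langle\psi|.$$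 Here $\mathrm{Tr}_j$ traces out the $j$-th qudit, the result being regarded as a state of all $n$ qudits by putting the maximally mixed state $I/q$ at position $j$. The code $\mathcal C$ is an $[n,k]$ code if $\dim_{\mathbb C}\mathcal C=q^k$. Put $$N_e(r,L,s)=\frac{2r-(L-1)s}{2}\,L+1,\qquad p_e=p_e(r,t,s)=\sum_{L=1}^{t}(-1)^{L+1}\binom tL\frac1{N_e(r,L,s)}.$$ **Theorem.** If $\mathcal C$ is an $[n,k]$ exact $(r,t,s)$-qLRC on qudits of local dimension $q$, then $$k\le n-\lceil n\,p_e\rceil-\bigl\lceil (n-\lceil n\,p_e\rceil)\,p_e\bigr\rceil .$$ -/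

import Mathlib

open scoped Matrix

/-- The Hilbert space `(ℂ^q)^{⊗ n}` of `n` qudits of local dimension `q`, written in its
computational basis: the basis vectors are labelled by the strings `Fin n → Fin q`. -/
abbrev QuditSpace (n q : ℕ) : Type := EuclideanSpace ℂ (Fin n → Fin q)

/-- Operators on the `n`-qudit Hilbert space, as matrices in the computational basis. -/
abbrev QuditOp (n q : ℕ) : Type := Matrix (Fin n → Fin q) (Fin n → Fin q) ℂ

/-- The density matrix `|ψ⟩⟨ψ|` of a state vector `ψ`. -/
noncomputable def pureDensity {n q : ℕ} (ψ : QuditSpace n q) : QuditOp n q :=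
  Matrix.of fun x y => ψ x * star (ψ y)

/-- The operator `K ⊗ I` on `n` qudits, where `K` acts on the qudits in `S` and the identity acts
on all qudits outside `S`. -/
noncomputable def extendOp {n q : ℕ} (S : Finset (Fin n))
    (K : Matrix (S → Fin q) (S → Fin q) ℂ) : QuditOp n q :=
  open Classical in
  Matrix.of fun x y =>
    if ∀ i, i ∉ S → x i = y i then K (fun i => x i) (fun i => y i) else 0

/-- `Φ` is a quantum channel supported on the qudits in `S`: it is `Φ_S ⊗ id`, where
`Φ_S (σ) = ∑ a, K a * σ * (K a)ᴴ` with `∑ a, (K a)ᴴ * K a = 1` is a channel (in operator-sum form)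
on the qudits in `S`. -/
def IsChannelOn {n q : ℕ} (S : Finset (Fin n)) (Φ : QuditOp n q →ₗ[ℂ] QuditOp n q) : Prop :=
  ∃ (m : ℕ) (K : Fin m → Matrix (S → Fin q) (S → Fin q) ℂ),
    (∑ a, (K a)ᴴ * K a = 1) ∧
      ∀ ρ, Φ ρ = ∑ a, extendOp S (K a) * ρ * (extendOp S (K a))ᴴ

/-- Tracing out the `j`-th qudit. The result is kept as an operator on all `n` qudits by putting
the maximally mixed state in the place of the lost qudit: this is `Tr_j (ρ) ⊗ I_j / q`
(for a qubit, `(ρ + X_j ρ X_j + Y_j ρ Y_j + Z_j ρ Z_j) / 4`). -/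
noncomputable def traceOut {n q : ℕ} (j : Fin n) (ρ : QuditOp n q) : QuditOp n q :=
  Matrix.of fun x y =>
    if x j = y j then
      (q : ℂ)⁻¹ * ∑ a : Fin q, ρ (Function.update x j a) (Function.update y j a)
    else 0

/-- The exact `(r,t,s)`-condition for a family `Γ l j` (with `l ∈ [t]`, `j ∈ [n]`) of subsets
of `[n]`. -/
structure ExactCondition {n : ℕ} (r t s : ℕ) (Γ : Fin t → Fin n → Finset (Fin n)) : Prop where
  card_eq : ∀ l j, (Γ l j).card = r + 1
  self_mem : ∀ l j, j ∈ Γ l j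
  card_inter : ∀ j l₁ l₂, l₁ ≠ l₂ → (Γ l₁ j ∩ Γ l₂ j).card = s + 1
  triple_inter : ∀ j l₁ l₂ l₃, l₁ ≠ l₂ → l₁ ≠ l₃ → l₂ ≠ l₃ →
    Γ l₁ j ∩ Γ l₂ j ∩ Γ l₃ j = {j}

/-- The quantum code `C` (a subspace of the `n`-qudit space) is an exact `(r,t,s)`-qLRC: there are
a family of recovery sets satisfying the exact `(r,t,s)`-condition and, for each `l` and `j`, a
channel supported on `Γ l j` which restores every code state after the `j`-th qudit is lost. -/
def IsExactQLRC {n q : ℕ} (r t s : ℕ) (C : Submodule ℂ (QuditSpace n q)) : Prop :=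
  ∃ Γ : Fin t → Fin n → Finset (Fin n), ExactCondition r t s Γ ∧
    ∀ (l : Fin t) (j : Fin n), ∃ Rec : QuditOp n q →ₗ[ℂ] QuditOp n q,
      IsChannelOn (Γ l j) Rec ∧
        ∀ ψ ∈ C, ‖ψ‖ = 1 → Rec (traceOut j (pureDensity ψ)) = pureDensity ψ

/-- `C` is an `[n,k]` code: it encodes `k` logical qudits into `n` physical qudits, that is, it has
dimension `q ^ k`. -/
def EncodesQudits {n q : ℕ} (k : ℕ) (C : Submodule ℂ (QuditSpace n q)) : Prop :=
  Module.finrank ℂ C = q ^ k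

/-- `N_e(r,L,s) = (2r - (L-1)s) / 2 * L + 1`. -/
def exactUnionSize (r L s : ℕ) : ℚ :=
  (2 * (r : ℚ) - ((L : ℚ) - 1) * s) / 2 * L + 1

/-- `p_e(r,t,s) = ∑_{1 ≤ L ≤ t} (-1)^(L+1) * binom(t, L) / N_e(r,L,s)`. -/
def pExact (r t s : ℕ) : ℚ :=
  ∑ L ∈ Finset.Icc 1 t, (-1) ^ (L + 1) * (t.choose L : ℚ) * (1 / exactUnionSize r L s)

/-! In a uniformly random ordering of `[n]`, position `j` comes last in a union of `L` of its
recovery sets with probability one over the size of that union. By inclusion-exclusion, `j` is last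
in some recovery set with probability `p_e`. Averaging gives an ordering in which at least `n * p_e`
positions have this property; a second averaging, over the complement of the chosen set, gives a
disjoint set (`ExactCondition.exists_disjoint_recoverable`).

Such a set satisfies the Knill-Laflamme condition (`IsSequentiallyRecoverable.isUncorrelated`):
positions are added from the latest to the earliest, so the recovery set of the new position avoids
those already added, and its Kraus operators commute with operators there.

Finally, two disjoint Knill-Laflamme sets `A`, `B` force `dim C ≤ q ^ (n - |A| - |B|)`. This
Singleton bound is proved by comparing ranks of marginals (`card_le_of_uncorrelated`) instead of
entropies. -/

/-! ### Random orderings -/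

/-- The permutations (regarded as orderings) in which `j` comes after every other element
of `U`. -/
def permsLast {n : ℕ} (U : Finset (Fin n)) (j : Fin n) : Finset (Equiv.Perm (Fin n)) :=
  {σ | ∀ i ∈ U, i ≠ j → σ i < σ j}

lemma card_permsLast_eq {n : ℕ} {U : Finset (Fin n)} {i j : Fin n} (hi : i ∈ U) (hj : j ∈ U) :
    (permsLast U i).card = (permsLast U j).card := by
  have key : ∀ {i j : Fin n}, i ∈ U → j ∈ U → ∀ σ ∈ permsLast U i,
      σ * Equiv.swap i j ∈ permsLast U j := by
    intro i j hi hj σ hσ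
    simp only [permsLast, Finset.mem_filter, Finset.mem_univ, true_and] at hσ ⊢
    intro m hm hmj
    rw [Equiv.Perm.mul_apply, Equiv.Perm.mul_apply, Equiv.swap_apply_right]
    by_cases hmi : m = i
    · subst hmi
      rw [Equiv.swap_apply_left]
      exact hσ j hj (Ne.symm hmj)
    · rw [Equiv.swap_apply_of_ne_of_ne hmi hmj]
      exact hσ m hm hmi
  refine Finset.card_bij' (fun σ _ => σ * Equiv.swap i j) (fun σ _ => σ * Equiv.swap j i)
    (key hi hj) (key hj hi) ?_ ?_
  · intro σ _
    rw [mul_assoc, Equiv.swap_comm j i, Equiv.swap_mul_self, mul_one]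
  · intro σ _
    rw [mul_assoc, Equiv.swap_comm j i, Equiv.swap_mul_self, mul_one]

/-- Each ordering has exactly one last element in `U`, and by symmetry all elements of `U` are
equally likely. -/
lemma card_mul_card_permsLast {n : ℕ} {U : Finset (Fin n)} {j : Fin n} (hj : j ∈ U) :
    U.card * (permsLast U j).card = n.factorial := by
  have hdisj : (U : Set (Fin n)).PairwiseDisjoint (permsLast U) := by
    intro a ha b hb hab
    refine Finset.disjoint_left.2 fun σ h1 h2 => ?_
    simp only [permsLast, Finset.mem_filter, Finset.mem_univ, true_and] at h1 h2
    exact lt_asymm (h1 b hb (Ne.symm hab)) (h2 a ha hab)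
  have hunion : U.biUnion (permsLast U) = Finset.univ := by
    refine Finset.eq_univ_of_forall fun σ => ?_
    obtain ⟨a, ha, hmax⟩ := Finset.exists_max_image U σ ⟨j, hj⟩
    refine Finset.mem_biUnion.2 ⟨a, ha, ?_⟩
    simp only [permsLast, Finset.mem_filter, Finset.mem_univ, true_and]
    exact fun i hi hia => lt_of_le_of_ne (hmax i hi) fun h => hia (σ.injective h)
  have h := Finset.card_biUnion hdisj
  rw [hunion, Finset.sum_congr rfl fun i hi => card_permsLast_eq hi hj, Finset.sum_const,
    Finset.card_univ, Fintype.card_perm, Fintype.card_fin, smul_eq_mul] at h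
  exact h.symm

/-- This makes the intersections in inclusion-exclusion computable: they are again events of the
same kind. -/
lemma permsLast_biUnion {n : ℕ} {ι : Type*} (S : Finset ι) (hS : S.Nonempty)
    (U : ι → Finset (Fin n)) (j : Fin n) :
    S.inf' hS (fun l => permsLast (U l) j) = permsLast (S.biUnion U) j := by
  classical
  ext σ
  rw [Finset.mem_inf']
  simp only [permsLast, Finset.mem_filter, Finset.mem_univ, true_and, Finset.mem_biUnion]
  constructor
  · rintro h i ⟨l, hl, hi⟩ hij
    exact h l hl i hi hij
  · exact fun h l hl i hi hij => h i ⟨l, hl, hi⟩ hij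

/-! ### Inclusion-exclusion over the recovery sets -/

namespace ExactCondition

variable {n r t s : ℕ} {Γ : Fin t → Fin n → Finset (Fin n)}

/-- Away from `j`, two sets share `s` points and three share none, so inclusion-exclusion stops at
pairs. -/
lemma card_biUnion_erase (h : ExactCondition r t s Γ) (j : Fin n) (S : Finset (Fin t)) :
    ((S.biUnion fun l => (Γ l j).erase j).card : ℚ)
      = S.card * r - S.card * (S.card - 1) / 2 * s := by
  induction S using Finset.induction_on with
  | empty => simp
  | insert a S ha ih =>
    have hinter : ((Γ a j).erase j ∩ S.biUnion fun l => (Γ l j).erase j).card = S.card * s := by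
      rw [Finset.inter_biUnion, Finset.card_biUnion, Finset.sum_const_nat]
      · intro l hl
        have hal : a ≠ l := fun h => ha (h ▸ hl)
        have he : (Γ a j).erase j ∩ (Γ l j).erase j = (Γ a j ∩ Γ l j).erase j := by
          ext i; simp only [Finset.mem_inter, Finset.mem_erase]; tauto
        rw [he, Finset.card_erase_of_mem
          (Finset.mem_inter.2 ⟨h.self_mem a j, h.self_mem l j⟩), h.card_inter j a l hal]
        rfl
      · intro l hl m hm hlm
        refine Finset.disjoint_left.2 fun i hi hi' => ?_
        simp only [Finset.mem_inter, Finset.mem_erase] at hi hi'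
        have := h.triple_inter j a l m (fun h => ha (h ▸ hl)) (fun h => ha (h ▸ hm)) hlm
        have hmem : i ∈ Γ a j ∩ Γ l j ∩ Γ m j := by
          simp only [Finset.mem_inter]; tauto
        rw [this, Finset.mem_singleton] at hmem
        exact hi.1.1 hmem
    have hcard := Finset.card_union_add_card_inter ((Γ a j).erase j)
      (S.biUnion fun l => (Γ l j).erase j)
    rw [hinter, Finset.card_erase_of_mem (h.self_mem a j), h.card_eq a j,
      Nat.add_sub_cancel] at hcard
    have hcard' := congrArg (Nat.cast : ℕ → ℚ) hcard
    push_cast at hcard'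
    rw [Finset.biUnion_insert, Finset.card_insert_of_notMem ha]
    push_cast
    linear_combination hcard' + ih

lemma card_biUnion (h : ExactCondition r t s Γ) (j : Fin n) {S : Finset (Fin t)}
    (hS : S.Nonempty) :
    ((S.biUnion fun l => Γ l j).card : ℚ) = exactUnionSize r S.card s := by
  obtain ⟨l, hl⟩ := hS
  have hj : j ∈ S.biUnion fun l => Γ l j := Finset.mem_biUnion.2 ⟨l, hl, h.self_mem l j⟩
  have he : (S.biUnion fun l => Γ l j).erase j = S.biUnion fun l => (Γ l j).erase j := by
    ext i; simp only [Finset.mem_erase, Finset.mem_biUnion]; tauto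
  have := h.card_biUnion_erase j S
  rw [← Finset.card_erase_add_one hj, he, Nat.cast_add, this, exactUnionSize]
  push_cast
  ring

/-- Inclusion-exclusion: the fraction of the orderings in which some recovery set of `j` ends
with `j` is `pExact r t s`. -/
lemma card_biUnion_permsLast (h : ExactCondition r t s Γ) (j : Fin n) :
    (((Finset.univ.biUnion fun l => permsLast (Γ l j) j).card : ℕ) : ℚ)
      = n.factorial * pExact r t s := by
  have hie := Finset.inclusion_exclusion_card_biUnion (Finset.univ : Finset (Fin t))
    fun l => permsLast (Γ l j) j
  have hterm : ∀ S : (Finset.univ : Finset (Fin t)).powerset.filter (·.Nonempty),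
      ((((-1 : ℤ) ^ (S.1.card + 1) * ((S.1.inf' (Finset.mem_filter.1 S.2).2
        fun l => permsLast (Γ l j) j).card : ℤ) : ℤ)) : ℚ)
        = (-1) ^ (S.1.card + 1) * (n.factorial * (1 / exactUnionSize r S.1.card s)) := by
    rintro ⟨S, hS⟩
    have hne : S.Nonempty := (Finset.mem_filter.1 hS).2
    obtain ⟨l, hl⟩ := id hne
    have hj : j ∈ S.biUnion fun l => Γ l j := Finset.mem_biUnion.2 ⟨l, hl, h.self_mem l j⟩
    have hc := congrArg (Nat.cast : ℕ → ℚ) (card_mul_card_permsLast hj)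
    have hpos : (0 : ℚ) < (S.biUnion fun l => Γ l j).card :=
      Nat.cast_pos.2 (Finset.card_pos.2 ⟨j, hj⟩)
    rw [Nat.cast_mul] at hc
    simp only [permsLast_biUnion S hne (fun l => Γ l j) j]
    rw [← h.card_biUnion j hne, ← hc]
    push_cast
    field_simp
  have hie' := congrArg (Int.cast : ℤ → ℚ) hie
  rw [Int.cast_natCast, Int.cast_sum, Finset.sum_congr rfl fun S _ => hterm S,
    Finset.sum_coe_sort (Finset.univ.powerset.filter (·.Nonempty)) (fun S : Finset (Fin t) =>
      (-1 : ℚ) ^ (S.card + 1) * (n.factorial * (1 / exactUnionSize r S.card s))),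
    Finset.sum_filter] at hie'
  -- Subsets are grouped by cardinality `L`; the empty one contributes nothing, which permits the
  -- shift to `1 ≤ L ≤ t`.
  rw [hie', Finset.sum_congr rfl fun S _ => if_congr Finset.card_pos.symm rfl rfl,
    Finset.sum_powerset_apply_card (fun L => if 0 < L then
      (-1 : ℚ) ^ (L + 1) * (n.factorial * (1 / exactUnionSize r L s)) else 0),
    Finset.card_univ, Fintype.card_fin, Finset.sum_range_succ', pExact, Finset.mul_sum,
    Finset.range_eq_Ico, Finset.sum_Ico_add' (fun L => t.choose L • (if 0 < L then
      (-1 : ℚ) ^ (L + 1) * (n.factorial * (1 / exactUnionSize r L s)) else 0)) 0 t 1]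
  simp only [lt_irrefl, if_false, smul_zero, add_zero, zero_add]
  have hIcc : Finset.Ico 1 (t + 1) = Finset.Icc 1 t := rfl
  rw [hIcc]
  refine Finset.sum_congr rfl fun L hL => ?_
  rw [if_pos (Nat.lt_of_succ_le (Finset.mem_Icc.1 hL).1), nsmul_eq_mul]
  ring

lemma pExact_nonneg (h : ExactCondition r t s Γ) (j : Fin n) : 0 ≤ pExact r t s := by
  have h1 := h.card_biUnion_permsLast j
  have h2 : (0 : ℚ) < n.factorial := Nat.cast_pos.2 n.factorial_pos
  refine nonneg_of_mul_nonneg_right ?_ h2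
  rw [← h1]
  exact Nat.cast_nonneg _

/-- Some ordering makes at least the fraction `pExact r t s` of the positions in `S` come last in
one of their recovery sets. -/
lemma exists_perm_le_card (h : ExactCondition r t s Γ) (S : Finset (Fin n)) :
    ∃ σ : Equiv.Perm (Fin n), (S.card : ℚ) * pExact r t s
      ≤ (({j ∈ S | ∃ l, ∀ i ∈ Γ l j, i ≠ j → σ i < σ j} : Finset (Fin n)).card : ℚ) := by
  by_contra! hlt
  have hsum := Finset.sum_lt_sum_of_nonempty
    (Finset.univ_nonempty (α := Equiv.Perm (Fin n))) fun σ _ => hlt σ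
  rw [Finset.sum_const, Finset.card_univ, Fintype.card_perm, Fintype.card_fin,
    nsmul_eq_mul] at hsum
  -- Double counting of pairs (ordering, good position): the average over orderings is exactly
  -- `S.card * pExact r t s`.
  have hswap : ∑ σ : Equiv.Perm (Fin n),
      (({j ∈ S | ∃ l, ∀ i ∈ Γ l j, i ≠ j → σ i < σ j} : Finset (Fin n)).card : ℚ)
      = ∑ j ∈ S, ((Finset.univ.biUnion fun l => permsLast (Γ l j) j).card : ℚ) := by
    simp only [Finset.card_filter, Nat.cast_sum]
    rw [Finset.sum_comm]
    refine Finset.sum_congr rfl fun j _ => ?_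
    rw [← Nat.cast_sum, ← Finset.card_filter]
    congr 2
    ext σ
    simp [permsLast]
  rw [hswap, Finset.sum_congr rfl fun j _ => h.card_biUnion_permsLast j, Finset.sum_const,
    nsmul_eq_mul] at hsum
  exact absurd hsum (by rw [mul_left_comm]; exact lt_irrefl _)

end ExactCondition

/-! ### Two disjoint recoverable sets -/

/-- Every position of `A` comes after the rest of one of its recovery sets, in some ordering of the
positions; such an `A` can be recovered one position after the other. -/
def IsSequentiallyRecoverable {n t : ℕ} (Γ : Fin t → Fin n → Finset (Fin n))
    (A : Finset (Fin n)) : Prop :=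
  ∃ σ : Fin n → ℕ, ∀ j ∈ A, ∃ l, ∀ i ∈ Γ l j, i ≠ j → σ i < σ j

lemma ExactCondition.exists_disjoint_recoverable {n r t s : ℕ}
    {Γ : Fin t → Fin n → Finset (Fin n)} (h : ExactCondition r t s Γ) (hn : 1 ≤ n) :
    ∃ A B : Finset (Fin n), Disjoint A B ∧ IsSequentiallyRecoverable Γ A ∧
      IsSequentiallyRecoverable Γ B ∧ (A.card : ℤ) = ⌈(n : ℚ) * pExact r t s⌉ ∧
      ⌈((n : ℚ) - (⌈(n : ℚ) * pExact r t s⌉ : ℚ)) * pExact r t s⌉ ≤ (B.card : ℤ) := by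
  obtain ⟨σ, hσ⟩ := h.exists_perm_le_card Finset.univ
  rw [Finset.card_univ, Fintype.card_fin] at hσ
  have hceil := Int.ceil_le.2 (hσ.trans_eq (Int.cast_natCast _).symm)
  have hnonneg : 0 ≤ ⌈(n : ℚ) * pExact r t s⌉ :=
    Int.ceil_nonneg (mul_nonneg (Nat.cast_nonneg n) (h.pExact_nonneg ⟨0, hn⟩))
  obtain ⟨m, hm⟩ := Int.eq_ofNat_of_zero_le hnonneg
  rw [hm] at hceil ⊢
  -- `A` is trimmed to exactly the ceiling, so that its complement has the size required in the
  -- second averaging.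
  obtain ⟨A, hA, hAm⟩ := Finset.exists_subset_card_eq (Int.ofNat_le.1 hceil)
  obtain ⟨τ, hτ⟩ := h.exists_perm_le_card Aᶜ
  refine ⟨A, {j ∈ Aᶜ | ∃ l, ∀ i ∈ Γ l j, i ≠ j → τ i < τ j},
    Finset.disjoint_left.2 fun i hi hi' => ?_, ⟨fun i => σ i, fun j hj => ?_⟩,
    -- Moving `A` to the front keeps all required inequalities, since `j ∉ A`; the shift by one puts
    -- everything else strictly above `A`.
    ⟨fun i => if i ∈ A then 0 else τ i + 1, fun j hj => ?_⟩, by rw [hAm], ?_⟩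
  · exact Finset.mem_compl.1 (Finset.mem_filter.1 hi').1 hi
  · obtain ⟨l, hl⟩ := (Finset.mem_filter.1 (hA hj)).2
    exact ⟨l, fun i hi hij => hl i hi hij⟩
  · obtain ⟨hjA, l, hl⟩ := Finset.mem_filter.1 hj
    refine ⟨l, fun i hi hij => ?_⟩
    have := Fin.lt_def.1 (hl i hi hij)
    simp only [if_neg (Finset.mem_compl.1 hjA)]
    split_ifs <;> omega
  · refine Int.ceil_le.2 ?_
    have hcard : ((Aᶜ.card : ℕ) : ℚ) = n - m := by
      have := Finset.card_add_card_compl A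
      rw [hAm, Fintype.card_fin] at this
      rw [eq_sub_iff_add_eq, add_comm]
      exact_mod_cast this
    rw [hcard] at hτ
    simpa using hτ

/-! ### Singleton bound for tensors -/

open scoped ComplexOrder in
/-- If both marginals of a tensor `T` on `α` and on `β` are uncorrelated with the index in `ρ`,
then `ρ` is at most as large as the remaining index set `γ`. -/
lemma rank_marginal_le {ρ α β γ : Type*} [Fintype ρ] [DecidableEq ρ] [Nonempty ρ]
    [Fintype α] [Fintype β] [Fintype γ] [DecidableEq α] [DecidableEq β] [DecidableEq γ]
    (T : ρ → α → β → γ → ℂ) (cA : Matrix α α ℂ) (cB : Matrix β β ℂ)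
    (hA : ∀ p p' a a', ∑ b, ∑ c, T p a b c * star (T p' a' b c) = if p = p' then cA a a' else 0)
    (hB : ∀ p p' b b', ∑ a, ∑ c, T p a b c * star (T p' a b' c) = if p = p' then cB b b' else 0) :
    Fintype.card ρ * cB.rank ≤ cA.rank * Fintype.card γ := by
  set M : Matrix α (ρ × β × γ) ℂ := Matrix.of fun a x => T x.1 a x.2.1 x.2.2 with hM
  set N : Matrix (ρ × β) (α × γ) ℂ := Matrix.of fun x y => T x.1 y.1 x.2 y.2 with hN
  have hrM : M.rank = cA.rank := by
    have h1 : M * Mᴴ = (Fintype.card ρ : ℂ) • cA := by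
      ext a a'
      simp only [hM, Matrix.mul_apply, Matrix.conjTranspose_apply, Matrix.of_apply,
        Fintype.sum_prod_type, hA, Matrix.smul_apply]
      simp
    rw [← Matrix.rank_self_mul_conjTranspose, h1, Matrix.rank_smul_of_mem_nonZeroDivisors]
    exact mem_nonZeroDivisors_of_ne_zero (Nat.cast_ne_zero.2 Fintype.card_ne_zero)
  -- `N * Nᴴ` is block diagonal with one copy of `cB` for each index in `ρ`.
  have hrN : Fintype.card ρ * cB.rank ≤ N.rank := by
    rw [← Matrix.rank_self_mul_conjTranspose N]
    let L : (ρ → LinearMap.range cB.mulVecLin) →ₗ[ℂ] (ρ × β → ℂ) :=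
      { toFun := fun f x => (f x.1 : β → ℂ) x.2
        map_add' := fun f g => by ext x; simp
        map_smul' := fun c f => by ext x; simp }
    have hL : Function.Injective L := fun f g hfg => by
      ext p b
      exact congrFun hfg (p, b)
    have hrange : LinearMap.range L ≤ LinearMap.range (N * Nᴴ).mulVecLin := by
      rintro _ ⟨f, rfl⟩
      choose g hg using fun p => (f p).2
      refine ⟨fun x => g x.1 x.2, ?_⟩
      ext ⟨p, b⟩
      have h2 : L f (p, b) = (cB *ᵥ g p) b := by
        rw [← Matrix.mulVecLin_apply, hg]; rfl
      rw [h2]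
      simp only [hN, Matrix.mulVecLin_apply, Matrix.mulVec, dotProduct, Matrix.mul_apply,
        Matrix.conjTranspose_apply, Matrix.of_apply, Fintype.sum_prod_type, hB, ite_mul, zero_mul]
      rw [Finset.sum_comm]
      simp
    have h3 := Submodule.finrank_mono hrange
    rw [LinearMap.finrank_range_of_inj hL, Module.finrank_pi_fintype, Finset.sum_const,
      Finset.card_univ, smul_eq_mul] at h3
    exact h3
  -- For each fixed `c`, the `α`-slice of a vector in the range of `Nᵀ` lies in the range of `M`.
  have hle : N.rank ≤ M.rank * Fintype.card γ := by
    rw [← Matrix.rank_transpose N]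
    let L : (γ → LinearMap.range M.mulVecLin) →ₗ[ℂ] (α × γ → ℂ) :=
      { toFun := fun f x => (f x.2 : α → ℂ) x.1
        map_add' := fun f g => by ext x; simp
        map_smul' := fun c f => by ext x; simp }
    have hrange : LinearMap.range Nᵀ.mulVecLin ≤ LinearMap.range L := by
      rintro _ ⟨w, rfl⟩
      refine ⟨fun c => ⟨_, (fun x => if x.2.2 = c then w (x.1, x.2.1) else 0), rfl⟩, ?_⟩
      ext ⟨a, c⟩
      simp [L, hM, hN, Matrix.mulVec, Matrix.vecMul, dotProduct, Fintype.sum_prod_type, mul_comm]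
    have h3 := (Submodule.finrank_mono hrange).trans (LinearMap.finrank_range_le L)
    rw [Module.finrank_pi_fintype, Finset.sum_const, Finset.card_univ, smul_eq_mul,
      mul_comm] at h3
    exact h3
  rw [← hrM]
  exact hrN.trans hle

open scoped ComplexOrder in
/-- A rank form of the quantum Singleton bound: if both the marginal of `T` on `α` and that on `β`
are uncorrelated with the index in `ρ`, then `ρ` is at most as large as `γ`. -/
lemma card_le_of_uncorrelated {ρ α β γ : Type*} [Fintype ρ] [DecidableEq ρ]
    [Fintype α] [Fintype β] [Fintype γ] [DecidableEq α] [DecidableEq β] [DecidableEq γ]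
    (T : ρ → α → β → γ → ℂ) (cA : Matrix α α ℂ) (cB : Matrix β β ℂ) (hT : ∀ p, T p ≠ 0)
    (hA : ∀ p p' a a', ∑ b, ∑ c, T p a b c * star (T p' a' b c) = if p = p' then cA a a' else 0)
    (hB : ∀ p p' b b', ∑ a, ∑ c, T p a b c * star (T p' a b' c) = if p = p' then cB b b' else 0) :
    Fintype.card ρ ≤ Fintype.card γ := by
  rcases isEmpty_or_nonempty ρ with hρ | hρ
  · simp
  have h1 := rank_marginal_le T cA cB hA hB
  -- The same bound with `α` and `β` exchanged; the larger of the two ranks, which is positive, then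
  -- cancels.
  have h2 := rank_marginal_le (fun p b a c => T p a b c) cB cA hB hA
  have hpos : 0 < cA.rank := by
    obtain ⟨p⟩ := hρ
    refine Nat.pos_of_ne_zero fun h0 => hT p ?_
    rw [Matrix.rank, Submodule.finrank_eq_zero, LinearMap.range_eq_bot] at h0
    funext a
    have hz : cA a a = 0 := by
      simpa using congrFun (LinearMap.congr_fun h0 (Pi.single a 1)) a
    have h3 := hA p p a a
    rw [if_pos rfl, hz, ← Fintype.sum_prod_type' fun b c => T p a b c * star (T p a b c)] at h3
    have h4 : (fun x : β × γ => T p a x.1 x.2) = 0 := dotProduct_self_star_eq_zero.1 h3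
    funext b c
    exact congrFun h4 (b, c)
  by_contra! hlt
  rcases le_total cA.rank cB.rank with h | h
  · nlinarith
  · nlinarith

/-! ### Local operators -/

/-- The string which is `w` on `S` and `x` elsewhere. -/
def overwrite {n q : ℕ} (S : Finset (Fin n)) (w : S → Fin q) (x : Fin n → Fin q) : Fin n → Fin q :=
  fun i => if h : i ∈ S then w ⟨i, h⟩ else x i

lemma extendOp_mulVec {n q : ℕ} (S : Finset (Fin n)) (K : Matrix (S → Fin q) (S → Fin q) ℂ)
    (f : (Fin n → Fin q) → ℂ) (x : Fin n → Fin q) :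
    (extendOp S K *ᵥ f) x = ∑ w, K (fun i => x i) w * f (overwrite S w x) := by
  simp only [extendOp, Matrix.mulVec, dotProduct, Matrix.of_apply]
  symm
  refine Finset.sum_of_injOn (fun w => overwrite S w x) ?_ (fun _ _ => Finset.mem_univ _) ?_ ?_
  · intro w _ w' _ h
    ext i
    have := congrFun h i.1
    simp only [overwrite, i.2, dif_pos] at this
    rw [this]
  · intro y _ hy
    rw [if_neg, zero_mul]
    refine fun h => hy ⟨fun i => y i, Finset.mem_coe.2 (Finset.mem_univ _), ?_⟩
    ext i
    by_cases hi : i ∈ S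
    · simp [overwrite, hi]
    · simp [overwrite, hi, h i hi]
  · intro w _
    rw [if_pos]
    · congr 2
      ext i
      simp [overwrite]
    · intro i hi
      simp [overwrite, hi]

lemma extendOp_mul {n q : ℕ} (S : Finset (Fin n)) (K L : Matrix (S → Fin q) (S → Fin q) ℂ) :
    extendOp S K * extendOp S L = extendOp S (K * L) := by
  refine Matrix.mulVec_injective (funext fun f => funext fun x => ?_)
  rw [← Matrix.mulVec_mulVec]
  simp only [extendOp_mulVec, Matrix.mul_apply, Finset.sum_mul, Finset.mul_sum]
  rw [Finset.sum_comm]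
  refine Finset.sum_congr rfl fun w' _ => Finset.sum_congr rfl fun w _ => ?_
  have h1 : (fun i : S => overwrite S w x i) = w := by ext i; simp [overwrite]
  have h2 : overwrite S w' (overwrite S w x) = overwrite S w' x := by
    ext i; by_cases hi : i ∈ S <;> simp [overwrite, hi]
  rw [mul_assoc, h1, h2]

lemma extendOp_conjTranspose {n q : ℕ} (S : Finset (Fin n))
    (K : Matrix (S → Fin q) (S → Fin q) ℂ) : (extendOp S K)ᴴ = extendOp S Kᴴ := by
  ext x y
  simp only [extendOp, Matrix.conjTranspose_apply, Matrix.of_apply]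
  by_cases h : ∀ i, i ∉ S → x i = y i
  · rw [if_pos h, if_pos fun i hi => (h i hi).symm]
  · rw [if_neg h, if_neg fun h' => h fun i hi => (h' i hi).symm, star_zero]

lemma extendOp_sum {n q m : ℕ} (S : Finset (Fin n))
    (K : Fin m → Matrix (S → Fin q) (S → Fin q) ℂ) :
    extendOp S (∑ a, K a) = ∑ a, extendOp S (K a) := by
  ext x y
  simp only [extendOp, Matrix.sum_apply, Matrix.of_apply]
  split_ifs <;> simp

lemma extendOp_one {n q : ℕ} (S : Finset (Fin n)) :
    extendOp S (1 : Matrix (S → Fin q) (S → Fin q) ℂ) = 1 := by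
  refine Matrix.mulVec_injective (funext fun f => funext fun x => ?_)
  rw [extendOp_mulVec, Matrix.one_mulVec, Finset.sum_eq_single fun i : S => x i]
  · rw [Matrix.one_apply_eq, one_mul]
    congr 1
    ext i; simp [overwrite]
  · intro w _ hw
    rw [Matrix.one_apply_ne (Ne.symm hw), zero_mul]
  · simp

/-- Trace preservation, in the form that inserts the Kraus operators into an inner product. -/
lemma sum_extendOp_dotProduct {n q m : ℕ} {S : Finset (Fin n)}
    {K : Fin m → Matrix (S → Fin q) (S → Fin q) ℂ} (hK : ∑ a, (K a)ᴴ * K a = 1)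
    (f g : (Fin n → Fin q) → ℂ) :
    ∑ a, star (extendOp S (K a) *ᵥ f) ⬝ᵥ (extendOp S (K a) *ᵥ g) = star f ⬝ᵥ g := by
  have h : ∑ a, (extendOp S (K a))ᴴ * extendOp S (K a) = 1 := by
    simp only [extendOp_conjTranspose, extendOp_mul]
    rw [← extendOp_sum, hK, extendOp_one]
  simp only [Matrix.star_mulVec, ← Matrix.dotProduct_mulVec, Matrix.mulVec_mulVec]
  rw [← dotProduct_sum, ← Matrix.sum_mulVec, h, Matrix.one_mulVec]

/-- The matrix unit `|u⟩⟨v|` on the qudits in `A`, extended by the identity; it depends only on the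
restrictions of `u` and `v` to `A`. -/
noncomputable def matrixUnitOn {n q : ℕ} (A : Finset (Fin n)) (u v : Fin n → Fin q) : QuditOp n q :=
  Matrix.of fun x y => if (∀ i ∈ A, x i = u i) ∧ y = A.piecewise v x then 1 else 0

lemma matrixUnitOn_mulVec {n q : ℕ} (A : Finset (Fin n)) (u v : Fin n → Fin q)
    (f : (Fin n → Fin q) → ℂ) (x : Fin n → Fin q) :
    (matrixUnitOn A u v *ᵥ f) x = if ∀ i ∈ A, x i = u i then f (A.piecewise v x) else 0 := by
  simp only [matrixUnitOn, Matrix.mulVec, dotProduct, Matrix.of_apply, ite_mul, one_mul, zero_mul]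
  by_cases h : ∀ i ∈ A, x i = u i
  · simp only [and_iff_right h, if_pos h]
    simp
  · simp [h]

lemma matrixUnitOn_empty {n q : ℕ} (u v : Fin n → Fin q) : matrixUnitOn ∅ u v = 1 := by
  refine Matrix.mulVec_injective (funext fun f => funext fun x => ?_)
  simp [matrixUnitOn_mulVec]

lemma matrixUnitOn_mul_of_disjoint {n q : ℕ} {A B : Finset (Fin n)} (h : Disjoint A B)
    (u v : Fin n → Fin q) :
    matrixUnitOn A u v * matrixUnitOn B u v = matrixUnitOn (A ∪ B) u v := by
  refine Matrix.mulVec_injective (funext fun f => funext fun x => ?_)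
  rw [← Matrix.mulVec_mulVec]
  simp only [matrixUnitOn_mulVec]
  have h1 : (∀ i ∈ B, A.piecewise v x i = u i) ↔ ∀ i ∈ B, x i = u i :=
    forall₂_congr fun i hi => by rw [Finset.piecewise_eq_of_notMem _ _ _ fun hA =>
      Finset.disjoint_left.1 h hA hi]
  have h2 : B.piecewise v (A.piecewise v x) = (A ∪ B).piecewise v x := by
    ext i
    by_cases hA : i ∈ A <;> by_cases hB : i ∈ B <;> simp [Finset.piecewise, hA, hB]
  rw [if_congr h1 rfl rfl, h2, ← ite_and]
  refine if_congr ?_ rfl rfl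
  simp only [Finset.mem_union, or_imp, forall_and]

lemma matrixUnitOn_commute {n q : ℕ} {A B : Finset (Fin n)} (h : Disjoint A B)
    (u v : Fin n → Fin q) : Commute (matrixUnitOn A u v) (matrixUnitOn B u v) := by
  rw [Commute, SemiconjBy, matrixUnitOn_mul_of_disjoint h, matrixUnitOn_mul_of_disjoint h.symm,
    Finset.union_comm]

lemma extendOp_commute_matrixUnitOn {n q : ℕ} {S A : Finset (Fin n)} (h : Disjoint S A)
    (K : Matrix (S → Fin q) (S → Fin q) ℂ) (u v : Fin n → Fin q) :
    Commute (extendOp S K) (matrixUnitOn A u v) := by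
  refine Matrix.mulVec_injective (funext fun f => funext fun x => ?_)
  rw [← Matrix.mulVec_mulVec, ← Matrix.mulVec_mulVec]
  simp only [matrixUnitOn_mulVec, extendOp_mulVec]
  have hA : ∀ i ∈ A, i ∉ S := fun i hi hS => Finset.disjoint_left.1 h hS hi
  have h1 : ∀ w, (∀ i ∈ A, overwrite S w x i = u i) ↔ ∀ i ∈ A, x i = u i := fun w =>
    forall₂_congr fun i hi => by simp [overwrite, hA i hi]
  have h2 : ∀ w, A.piecewise v (overwrite S w x) = overwrite S w (A.piecewise v x) := fun w => by
    ext i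
    by_cases hi : i ∈ A
    · simp [overwrite, hi, hA i hi]
    · by_cases hS : i ∈ S <;> simp [overwrite, hi, hS]
  have h3 : (fun i : S => A.piecewise v x i) = fun i : S => x i := by
    ext i
    rw [Finset.piecewise_eq_of_notMem _ _ _ fun hi => hA _ hi i.2]
  simp only [h1, h2, h3]
  split_ifs <;> simp

/-- Splitting `|u⟩⟨v|` as `(|u⟩⟨u|)ᴴ |u⟩⟨v|` puts a matrix unit on each side of an inner product,
ready for a Kraus operator to act on both. -/
lemma matrixUnitOn_eq_conjTranspose_mul {n q : ℕ} (A : Finset (Fin n)) (u v : Fin n → Fin q) :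
    matrixUnitOn A u v = (matrixUnitOn A u u)ᴴ * matrixUnitOn A u v := by
  have h1 : (matrixUnitOn A u u)ᴴ = matrixUnitOn A u u := by
    have h2 : matrixUnitOn A u u
        = Matrix.diagonal fun x => if ∀ i ∈ A, x i = u i then (1 : ℂ) else 0 := by
      refine Matrix.mulVec_injective (funext fun f => funext fun x => ?_)
      rw [matrixUnitOn_mulVec, Matrix.mulVec_diagonal, ite_mul, one_mul, zero_mul]
      refine if_ctx_congr Iff.rfl (fun h => ?_) fun _ => rfl
      congr 1
      ext i
      by_cases hi : i ∈ A <;> simp [hi, h]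
    rw [h2, Matrix.diagonal_conjTranspose]
    congr 1
    ext x
    simp [apply_ite star]
  rw [h1]
  refine Matrix.mulVec_injective (funext fun f => funext fun x => ?_)
  rw [← Matrix.mulVec_mulVec]
  simp only [matrixUnitOn_mulVec]
  by_cases h : ∀ i ∈ A, x i = u i
  · have h3 : ∀ i ∈ A, A.piecewise u x i = u i := fun i hi => Finset.piecewise_eq_of_mem _ _ _ hi
    rw [if_pos h, if_pos h, if_pos h3]
    congr 1
    ext i
    by_cases hi : i ∈ A <;> simp [hi]
  · rw [if_neg h, if_neg h]

/-! ### From recovery to the Knill-Laflamme condition -/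

-- The part `χ` of `w i` orthogonal to `f` vanishes: evaluating both sides at `χ` gives a sum of
-- squares equal to zero.
open scoped ComplexOrder in
lemma exists_eq_smul_of_sum_vecMulVec {X ι : Type*} [Fintype X] [Fintype ι] {w : ι → X → ℂ}
    {f : X → ℂ} (hf : f ≠ 0)
    (h : ∑ i, Matrix.vecMulVec (w i) (star (w i)) = Matrix.vecMulVec f (star f)) (i : ι) :
    ∃ c : ℂ, w i = c • f := by
  have hff : star f ⬝ᵥ f ≠ 0 := fun h0 => hf (dotProduct_star_self_eq_zero.1 h0)
  set c := (star f ⬝ᵥ w i) / (star f ⬝ᵥ f) with hc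
  refine ⟨c, ?_⟩
  set χ := w i - c • f with hχ
  have hfχ : star f ⬝ᵥ χ = 0 := by
    rw [hχ, dotProduct_sub, dotProduct_smul, smul_eq_mul, hc, div_mul_cancel₀ _ hff, sub_self]
  have hχf : star χ ⬝ᵥ f = 0 := by
    rw [Matrix.star_dotProduct, hfχ, star_zero]
  have hz : (fun i => star χ ⬝ᵥ w i) = 0 := by
    refine dotProduct_self_star_eq_zero.1 ?_
    have h1 := congrArg (fun M : Matrix X X ℂ => star χ ⬝ᵥ (M *ᵥ χ)) h
    simp only [Matrix.sum_mulVec, dotProduct_sum, Matrix.vecMulVec_mulVec, hfχ,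
      dotProduct_smul, MulOpposite.op_zero, zero_smul, MulOpposite.smul_eq_mul_unop,
      MulOpposite.unop_op] at h1
    rw [dotProduct_zero] at h1
    rw [← h1]
    refine Finset.sum_congr rfl fun i _ => ?_
    rw [Pi.star_apply, ← Matrix.star_dotProduct]
  have hχw : star χ ⬝ᵥ w i = 0 := congrFun hz i
  have hχχ : star χ ⬝ᵥ χ = 0 := by
    conv_lhs => rw [hχ]
    rw [← hχ, dotProduct_sub, dotProduct_smul, hχw, hχf, smul_zero, sub_zero]
  exact sub_eq_zero.1 (dotProduct_star_self_eq_zero.1 hχχ)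

/-- A linear map having every nonzero vector as an eigenvector is a scalar. -/
lemma exists_smul_of_forall_exists_smul {X : Type*} [Fintype X] {C : Submodule ℂ (X → ℂ)}
    {M : Matrix X X ℂ} (h : ∀ f ∈ C, f ≠ 0 → ∃ c : ℂ, M *ᵥ f = c • f) :
    ∃ c : ℂ, ∀ f ∈ C, M *ᵥ f = c • f := by
  have h' : ∀ f ∈ C, ∃ c : ℂ, M *ᵥ f = c • f := fun f hf => by
    by_cases h0 : f = 0
    · exact ⟨0, by simp [h0]⟩
    · exact h f hf h0
  have hmap : ∀ f ∈ C, M.mulVecLin f ∈ C := fun f hf => by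
    obtain ⟨c, hc⟩ := h' f hf
    rw [Matrix.mulVecLin_apply, hc]
    exact C.smul_mem c hf
  obtain ⟨c, hc⟩ := LinearMap.exists_eq_smul_id_of_forall_notLinearIndependent
    (f := M.mulVecLin.restrict hmap) fun v hv => by
      obtain ⟨c, hc⟩ := h' v v.2
      have := LinearIndependent.pair_iff.1 hv c (-1) (by
        ext x
        simpa [sub_eq_zero, add_neg_eq_zero] using (congrFun hc x).symm)
      simp at this
  refine ⟨c, fun f hf => ?_⟩
  have := congrArg Subtype.val (LinearMap.congr_fun hc ⟨f, hf⟩)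
  simpa using this

/-- Losing qudit `j` is the channel with Kraus operators `q^(-1/2) |a⟩⟨b|` at `j`. -/
lemma traceOut_vecMulVec {n q : ℕ} (j : Fin n) (f : (Fin n → Fin q) → ℂ) :
    traceOut j (Matrix.vecMulVec f (star f)) = ∑ p : Fin q × Fin q, (q : ℂ)⁻¹ •
      Matrix.vecMulVec (matrixUnitOn {j} (fun _ => p.1) (fun _ => p.2) *ᵥ f)
        (star (matrixUnitOn {j} (fun _ => p.1) (fun _ => p.2) *ᵥ f)) := by
  have hpw : ∀ (x : Fin n → Fin q) (b : Fin q),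
      ({j} : Finset (Fin n)).piecewise (fun _ => b) x = Function.update x j b := fun x b => by
    rw [Finset.piecewise_singleton]
  ext x y
  simp only [traceOut, Matrix.of_apply, Matrix.sum_apply, Matrix.smul_apply,
    Matrix.vecMulVec_apply, Pi.star_apply, matrixUnitOn_mulVec, Finset.mem_singleton,
    forall_eq, hpw, Fintype.sum_prod_type, apply_ite star, star_zero]
  split_ifs with h
  · symm
    rw [Finset.sum_eq_single (x j)]
    · simp [h, Finset.mul_sum]
    · intro b _ hb
      simp [Ne.symm hb]
    · simp
  · symm
    refine Finset.sum_eq_zero fun a _ => Finset.sum_eq_zero fun b _ => ?_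
    by_cases hx : x j = a
    · have hy : y j ≠ a := fun hy => h (hx.trans hy.symm)
      simp [hy]
    · simp [hx]

/-- The code of state vectors, as a space of functions on the computational basis. -/
def codeFunctions {n q : ℕ} (C : Submodule ℂ (QuditSpace n q)) :
    Submodule ℂ ((Fin n → Fin q) → ℂ) :=
  C.map (WithLp.linearEquiv 2 ℂ ((Fin n → Fin q) → ℂ)).toLinearMap

lemma mul_vecMulVec_star_mul_conjTranspose {X : Type*} [Fintype X] (M : Matrix X X ℂ)
    (f : X → ℂ) :
    M * Matrix.vecMulVec f (star f) * Mᴴ = Matrix.vecMulVec (M *ᵥ f) (star (M *ᵥ f)) := by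
  rw [Matrix.mul_vecMulVec, Matrix.vecMulVec_mul, Matrix.star_mulVec]

/-- If a channel in operator-sum form restores the code after the loss of the `j`-th qudit, then
each of its Kraus operators, composed with any matrix unit at `j`, acts on the code as a scalar. -/
lemma exists_smul_of_recovery {n q : ℕ} (hq : q ≠ 0) {C : Submodule ℂ (QuditSpace n q)}
    {S : Finset (Fin n)} {j : Fin n} {m : ℕ} {K : Fin m → Matrix (S → Fin q) (S → Fin q) ℂ}
    (h : ∀ ψ ∈ C, ‖ψ‖ = 1 → ∑ a, extendOp S (K a) * traceOut j (pureDensity ψ) *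
      (extendOp S (K a))ᴴ = pureDensity ψ) (a : Fin m) (u v : Fin n → Fin q) :
    ∃ c : ℂ, ∀ f ∈ codeFunctions C,
      extendOp S (K a) *ᵥ (matrixUnitOn {j} u v *ᵥ f) = c • f := by
  have hunit : matrixUnitOn {j} u v = matrixUnitOn {j} (fun _ => u j) (fun _ => v j) := by
    refine Matrix.mulVec_injective (funext fun f => funext fun x => ?_)
    simp only [matrixUnitOn_mulVec, Finset.mem_singleton, forall_eq, Finset.piecewise_singleton]
  simp only [Matrix.mulVec_mulVec]
  refine exists_smul_of_forall_exists_smul ?_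
  rintro _ ⟨ψ, hψ, rfl⟩ hne
  have hψ0 : ψ ≠ 0 := fun h0 => hne (by rw [h0, map_zero])
  obtain ⟨φ, b, hb, hφ, hφ1⟩ : ∃ (φ : QuditSpace n q) (b : ℂ), b ≠ 0 ∧ φ = b • ψ ∧ ‖φ‖ = 1 :=
    ⟨_, (‖ψ‖ : ℂ)⁻¹, inv_ne_zero (Complex.ofReal_ne_zero.2 (norm_ne_zero_iff.2 hψ0)), rfl,
      norm_smul_inv_norm hψ0⟩
  have hφ0 : φ.ofLp ≠ 0 := fun h0 => by
    have : φ = 0 := by ext x; exact congrFun h0 x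
    rw [this, norm_zero] at hφ1
    exact zero_ne_one hφ1
  have hpure : pureDensity φ = Matrix.vecMulVec φ.ofLp (star φ.ofLp) := rfl
  have h1 := h φ (hφ ▸ C.smul_mem b hψ) hφ1
  rw [hpure, traceOut_vecMulVec] at h1
  simp only [Matrix.mul_sum, Matrix.sum_mul, Matrix.mul_smul, Matrix.smul_mul,
    mul_vecMulVec_star_mul_conjTranspose, Matrix.mulVec_mulVec] at h1
  -- `κ = q^(-1/2)` is absorbed into the vectors to leave an unweighted sum of rank-one terms.
  obtain ⟨κ, hκ⟩ : ∃ κ : ℝ, κ ≠ 0 ∧ κ ^ 2 = (q : ℝ)⁻¹ :=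
    ⟨√((q : ℝ)⁻¹), by positivity, Real.sq_sqrt (by positivity)⟩
  have hκ2 : (κ : ℂ) * star (κ : ℂ) = (q : ℂ)⁻¹ := by
    rw [Complex.star_def, Complex.conj_ofReal, ← pow_two]
    rw [← Complex.ofReal_pow, hκ.2, Complex.ofReal_inv, Complex.ofReal_natCast]
  obtain ⟨c, hc⟩ := exists_eq_smul_of_sum_vecMulVec (ι := Fin m × (Fin q × Fin q))
    (w := fun p => (κ : ℂ) • ((extendOp S (K p.1) *
      matrixUnitOn {j} (fun _ => p.2.1) (fun _ => p.2.2)) *ᵥ φ.ofLp)) hφ0 (by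
      rw [← h1, Fintype.sum_prod_type]
      refine Finset.sum_congr rfl fun a _ => Finset.sum_congr rfl fun p _ => ?_
      rw [star_smul, Matrix.vecMulVec_smul, Matrix.smul_vecMulVec, smul_smul, mul_comm, hκ2])
      (a, (u j, v j))
  have hψφ : ψ.ofLp = b⁻¹ • φ.ofLp := by
    rw [hφ, WithLp.ofLp_smul, smul_smul, inv_mul_cancel₀ hb, one_smul]
  have hκ0 : (κ : ℂ) ≠ 0 := Complex.ofReal_ne_zero.2 hκ.1
  refine ⟨(κ : ℂ)⁻¹ * c, ?_⟩
  change _ *ᵥ ψ.ofLp = _ • ψ.ofLp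
  rw [hunit, hψφ, Matrix.mulVec_smul, mul_smul, smul_comm c, ← hc, smul_comm b⁻¹, smul_smul (κ : ℂ)⁻¹,
    inv_mul_cancel₀ hκ0, one_smul]

/-- The Knill-Laflamme condition: the operators on the qudits in `A` cannot distinguish the states
of the code. -/
def IsUncorrelated {n q : ℕ} (C : Submodule ℂ ((Fin n → Fin q) → ℂ)) (A : Finset (Fin n)) : Prop :=
  ∀ u v, ∃ c : ℂ, ∀ f ∈ C, ∀ g ∈ C, star f ⬝ᵥ (matrixUnitOn A u v *ᵥ g) = c * (star f ⬝ᵥ g)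

lemma isUncorrelated_empty {n q : ℕ} (C : Submodule ℂ ((Fin n → Fin q) → ℂ)) :
    IsUncorrelated C ∅ := fun u v =>
  ⟨1, fun f _ g _ => by rw [matrixUnitOn_empty, Matrix.one_mulVec, one_mul]⟩

/-- Kraus operators are inserted between the two factors of the matrix unit at `j`. They commute
with operators on `A`, so each side reduces to a scalar and only the expectation on `A` remains. -/
lemma IsUncorrelated.insert {n q m : ℕ} {C : Submodule ℂ ((Fin n → Fin q) → ℂ)}
    {A S : Finset (Fin n)} (h : IsUncorrelated C A) {j : Fin n} (hj : j ∉ A) (hS : Disjoint S A)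
    {K : Fin m → Matrix (S → Fin q) (S → Fin q) ℂ} (hK : ∑ a, (K a)ᴴ * K a = 1)
    (hsmul : ∀ a u v, ∃ c : ℂ, ∀ f ∈ C,
      extendOp S (K a) *ᵥ (matrixUnitOn {j} u v *ᵥ f) = c • f) :
    IsUncorrelated C (insert j A) := by
  intro u v
  choose c hc using hsmul
  obtain ⟨d, hd⟩ := h u v
  have hdisj : Disjoint {j} A := Finset.disjoint_singleton_left.2 hj
  refine ⟨(∑ a, star (c a u u) * c a u v) * d, fun f hf g hg => ?_⟩
  rw [Finset.insert_eq, ← matrixUnitOn_mul_of_disjoint hdisj, ← Matrix.mulVec_mulVec,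
    matrixUnitOn_eq_conjTranspose_mul {j} u v, ← Matrix.mulVec_mulVec, Matrix.dotProduct_mulVec,
    ← Matrix.star_mulVec, ← sum_extendOp_dotProduct hK, Finset.sum_mul, Finset.sum_mul]
  refine Finset.sum_congr rfl fun a _ => ?_
  have h1 : extendOp S (K a) *ᵥ (matrixUnitOn {j} u v *ᵥ (matrixUnitOn A u v *ᵥ g))
      = c a u v • (matrixUnitOn A u v *ᵥ g) := by
    rw [← Matrix.mulVec_smul, ← hc a u v g hg]
    simp only [Matrix.mulVec_mulVec]
    rw [(matrixUnitOn_commute hdisj u v).eq, ← mul_assoc,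
      (extendOp_commute_matrixUnitOn hS (K a) u v).eq, mul_assoc]
  rw [h1, hc a u u f hf, star_smul, smul_dotProduct, dotProduct_smul, hd f hf g hg]
  simp only [smul_eq_mul]
  ring

lemma IsSequentiallyRecoverable.isUncorrelated {n q t : ℕ} (hq : q ≠ 0)
    {C : Submodule ℂ (QuditSpace n q)} {Γ : Fin t → Fin n → Finset (Fin n)} {A : Finset (Fin n)}
    (hA : IsSequentiallyRecoverable Γ A)
    (hRec : ∀ (l : Fin t) (j : Fin n), ∃ Rec : QuditOp n q →ₗ[ℂ] QuditOp n q,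
      IsChannelOn (Γ l j) Rec ∧
        ∀ ψ ∈ C, ‖ψ‖ = 1 → Rec (traceOut j (pureDensity ψ)) = pureDensity ψ) :
    IsUncorrelated (codeFunctions C) A := by
  obtain ⟨σ, hσ⟩ := hA
  revert hσ
  -- The new `j` has the least `σ`-value, and the rest of its recovery set lies strictly below it,
  -- hence outside `A`.
  refine Finset.induction_on_min_value σ A (fun _ => isUncorrelated_empty _) ?_
  intro j A hj hmin ih hσ
  obtain ⟨l, hl⟩ := hσ j (Finset.mem_insert_self j A)
  obtain ⟨Rec, ⟨m, K, hK, hRecK⟩, hRecC⟩ := hRec l j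
  refine (ih fun i hi => hσ i (Finset.mem_insert_of_mem hi)).insert hj (S := Γ l j)
    (Finset.disjoint_left.2 fun i hi hiA => ?_) hK
    (exists_smul_of_recovery hq fun ψ hψ hψ1 => by rw [← hRecK, hRecC ψ hψ hψ1])
  exact absurd (hl i hi fun h => hj (h ▸ hiA)) (hmin i hiA).not_gt

/-! ### Singleton bound for codes -/

/-- Strings on `[n]` as triples of strings on disjoint `A`, `B` and on the remaining positions. -/
def splitString {n q : ℕ} {A B : Finset (Fin n)} (h : Disjoint A B) :
    (A → Fin q) × (B → Fin q) × (((A ∪ B)ᶜ : Finset (Fin n)) → Fin q) ≃ (Fin n → Fin q) where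
  toFun w i := if hA : i ∈ A then w.1 ⟨i, hA⟩ else if hB : i ∈ B then w.2.1 ⟨i, hB⟩ else
    w.2.2 ⟨i, by simp [hA, hB]⟩
  invFun x := (fun i => x i, fun i => x i, fun i => x i)
  left_inv := by
    rintro ⟨a, b, c⟩
    refine Prod.ext (funext fun i => ?_) (Prod.ext (funext fun i => ?_) (funext fun i => ?_))
    · simp
    · simp [Finset.disjoint_right.1 h i.2]
    · have hi := i.2
      simp only [Finset.mem_compl, Finset.mem_union, not_or] at hi
      simp [hi.1, hi.2]
  right_inv x := by
    ext i
    by_cases hA : i ∈ A <;> by_cases hB : i ∈ B <;> simp [hA, hB]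

/-- A rank form of the quantum Singleton bound. -/
lemma finrank_le_of_isUncorrelated {n q : ℕ} (hq : 0 < q) {C : Submodule ℂ (QuditSpace n q)}
    {A B : Finset (Fin n)} (h : Disjoint A B) (hA : IsUncorrelated (codeFunctions C) A)
    (hB : IsUncorrelated (codeFunctions C) B) :
    Module.finrank ℂ C ≤ q ^ (n - (A.card + B.card)) := by
  -- An arbitrary filler: the matrix units on `A` and `B` ignore it.
  let x₀ : Fin n → Fin q := fun _ => ⟨0, hq⟩
  choose cA hcA using fun u v : A → Fin q => hA (overwrite A u x₀) (overwrite A v x₀)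
  choose cB hcB using fun u v : B → Fin q => hB (overwrite B u x₀) (overwrite B v x₀)
  let e := stdOrthonormalBasis ℂ C
  let F : Fin (Module.finrank ℂ C) → (Fin n → Fin q) → ℂ := fun p => (e p : QuditSpace n q).ofLp
  have hF : ∀ p, F p ∈ codeFunctions C := fun p => ⟨_, (e p).2, rfl⟩
  have hdot : ∀ p p', star (F p') ⬝ᵥ F p = if p = p' then 1 else 0 := fun p p' => by
    have h1 := orthonormal_iff_ite.1 e.orthonormal p' p
    rw [Submodule.coe_inner, EuclideanSpace.inner_eq_star_dotProduct, dotProduct_comm] at h1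
    rw [h1]
    simp only [eq_comm]
  have hcard := card_le_of_uncorrelated (fun p a b c => F p (splitString h (a, b, c)))
    -- Transposed, since the conjugated factor, with index `a'`, is the bra.
    (Matrix.of fun a a' => cA a' a) (Matrix.of fun b b' => cB b' b) ?_ ?_ ?_
  · rw [Fintype.card_fin, Fintype.card_fun, Fintype.card_fin, Fintype.card_coe,
      Finset.card_compl, Fintype.card_fin, Finset.card_union_of_disjoint h] at hcard
    exact hcard
  · intro p hp
    have h0 : F p = 0 := by
      ext x
      obtain ⟨w, rfl⟩ := (splitString h).surjective x
      exact congrFun (congrFun (congrFun hp w.1) w.2.1) w.2.2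
    have := hdot p p
    rw [h0, dotProduct_zero, if_pos rfl] at this
    exact zero_ne_one this
  · intro p p' a a'
    have h1 := hcA a' a (F p') (hF p') (F p) (hF p)
    rw [hdot, mul_ite, mul_one, mul_zero] at h1
    rw [Matrix.of_apply, ← h1, dotProduct, ← (splitString h).sum_comp, Fintype.sum_prod_type,
      Finset.sum_eq_single a']
    · rw [Fintype.sum_prod_type]
      refine Finset.sum_congr rfl fun b _ => Finset.sum_congr rfl fun c _ => ?_
      rw [matrixUnitOn_mulVec, if_pos, mul_comm, Pi.star_apply]
      · congr 2
        ext i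
        by_cases hi : i ∈ A <;> simp [splitString, overwrite, hi]
      · intro i hi
        simp [splitString, overwrite, hi]
    · intro a'' _ hne
      refine Finset.sum_eq_zero fun w _ => ?_
      rw [matrixUnitOn_mulVec, if_neg, mul_zero]
      refine fun hall => hne (funext fun i => ?_)
      simpa [splitString, overwrite] using hall i i.2
    · simp
  · intro p p' b b'
    have h1 := hcB b' b (F p') (hF p') (F p) (hF p)
    rw [hdot, mul_ite, mul_one, mul_zero] at h1
    rw [Matrix.of_apply, ← h1, dotProduct, ← (splitString h).sum_comp, Fintype.sum_prod_type]
    refine Finset.sum_congr rfl fun a _ => ?_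
    rw [Fintype.sum_prod_type, Finset.sum_eq_single b']
    · refine Finset.sum_congr rfl fun c _ => ?_
      rw [matrixUnitOn_mulVec, if_pos, mul_comm, Pi.star_apply]
      · congr 2
        ext i
        by_cases hi : i ∈ B
        · simp [splitString, overwrite, hi, Finset.disjoint_right.1 h hi]
        · simp [splitString, hi]
      · intro i hi
        simp [splitString, overwrite, hi, Finset.disjoint_right.1 h hi]
    · intro b'' _ hne
      refine Finset.sum_eq_zero fun w _ => ?_
      rw [matrixUnitOn_mulVec, if_neg, mul_zero]
      refine fun hall => hne (funext fun i => ?_)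
      simpa [splitString, overwrite, Finset.disjoint_right.1 h i.2] using hall i i.2
    · simp

theorem mainTheorem2 (n k q r t s : ℕ) (hq : 2 ≤ q) (hn : 1 ≤ n) (hr : 1 ≤ r) (ht : 1 ≤ t)
    (hs : 1 ≤ s) (C : Submodule ℂ (QuditSpace n q)) (hk : EncodesQudits k C)
    (hC : IsExactQLRC r t s C) :
    (k : ℤ) ≤ (n : ℤ) - ⌈(n : ℚ) * pExact r t s⌉
      - ⌈((n : ℚ) - (⌈(n : ℚ) * pExact r t s⌉ : ℚ)) * pExact r t s⌉ := by
  obtain ⟨Γ, hΓ, hRec⟩ := hC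
  obtain ⟨A, B, hAB, hA, hB, hAcard, hBcard⟩ := hΓ.exists_disjoint_recoverable hn
  have hq0 : q ≠ 0 := by omega
  have h := finrank_le_of_isUncorrelated (Nat.pos_of_ne_zero hq0) hAB
    (hA.isUncorrelated hq0 hRec) (hB.isUncorrelated hq0 hRec)
  rw [hk] at h
  have hkn := (Nat.pow_le_pow_iff_right hq).1 h
  -- Rules out truncation in the natural subtraction `n - (A.card + B.card)`.
  have hsum : A.card + B.card ≤ n := by
    rw [← Finset.card_union_of_disjoint hAB]
    exact card_finset_fin_le _
  omega
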